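/- Let $X$ be a finite-dimensional real normed space with $\dim X \geq 1$ that is analytic, i.e. the restriction of the norm to $X \setminus \{0\}$ is a real analytic function, and let $G=(V,E)$ be a finite simple graph. A placement is an element $p=(p_v)_{v\in V}$ of $X^V$. The rigidity map is $$f_G : X^V \to \mathbb{R}^E, \qquad (x_v)_{v \in V} \mapsto \left(\tfrac12 \|x_v-x_w\|^2\right)_{vw\in E}.$$ A placement $p$ of $G$ is well-positioned if $f_G$ is differentiable at $p$ and $p_v \neq p_w$ for every edge $vw \in E$. It is regular if it is well-positioned and the rank of the derivative $df_G(p)$ is maximal among all well-positioned placements of $G$ in $X$. It is strongly regular if it is well-positioned and every placement $q \in X^V$ with $f_G(q)=f_G(p)$ is a regular placement of $G$. A placement $p \in X^V$ is completely regular (respectively, completely strongly regular) if for every graph $H$ with vertex set $V$, $p$ is a well-positioned and regular (respectively, well-positioned and strongly regular) placement of $H$. A subset of $X^V$ is conull if its complement has Lebesgue measure zero. Then each of the following four sets is an open conull subset of $X^V$: the set $\operatorname{Str}(G;X)$ of strongly regular placements of $G$ in $X$; the set $\operatorname{ComStr}(V;X)$ of completely strongly regular placements of $V$ in $X$; the set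 $\operatorname{Reg}(G;X)$ of regular placements of $G$ in $X$; and the set $\operatorname{Com}(V;X)$ of completely regular placements of $V$ in $X$. -/

import Mathlib

open MeasureTheory

noncomputable section

/-- A finite-dimensional real normed space is *analytic* if the restriction of its norm to the
complement of the origin is a real analytic function. -/
def IsAnalyticNormedSpace (X : Type*) [NormedAddCommGroup X] [NormedSpace ℝ X] : Prop :=
  AnalyticOnNhd ℝ (fun x : X => ‖x‖) {x : X | x ≠ 0}

/-- The quantity `½ ‖p v - p w‖ ^ 2` attached to the unordered pair `vw`. -/
def halfSqDist {V X : Type*} [NormedAddCommGroup X] (p : V → X) : Sym2 V → ℝ :=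
  Sym2.lift ⟨fun v w => (1 / 2 : ℝ) * ‖p v - p w‖ ^ 2, fun v w => by
    simp only [norm_sub_rev]⟩

/-- The rigidity map `f_G : X ^ V → ℝ ^ E`, sending `p` to `(½ ‖p v - p w‖ ^ 2)` over the edges
`vw` of `G`. -/
def rigidityMap {V : Type*} (G : SimpleGraph V) (X : Type*) [NormedAddCommGroup X] :
    (V → X) → (G.edgeSet → ℝ) :=
  fun p e => halfSqDist p (e : Sym2 V)

section Frameworks

variable {V : Type*} (G : SimpleGraph V) {X : Type*} [NormedAddCommGroup X] [NormedSpace ℝ X]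

/-- A placement `p` of `G` is *well-positioned* if the rigidity map is differentiable at `p` and
the end points of every edge are placed at distinct points. -/
def IsWellPositioned (p : V → X) : Prop :=
  DifferentiableAt ℝ (rigidityMap G X) p ∧ ∀ v w : V, G.Adj v w → p v ≠ p w

/-- The rigidity operator of `(G, p)`: the derivative of the rigidity map at `p`. -/
def rigidityOperator (p : V → X) : (V → X) →L[ℝ] (G.edgeSet → ℝ) :=
  fderiv ℝ (rigidityMap G X) p

/-- The rank of the rigidity operator of `(G, p)`. -/
def rigidityRank (p : V → X) : ℕ :=
  Module.finrank ℝ (LinearMap.range (rigidityOperator G p : (V → X) →ₗ[ℝ] (G.edgeSet → ℝ)))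

/-- A well-positioned framework is *regular* if its rigidity operator has maximal rank, among all
well-positioned placements of the same graph in the same space. -/
def IsRegularPlacement (p : V → X) : Prop :=
  IsWellPositioned G p ∧ ∀ q : V → X, IsWellPositioned G q → rigidityRank G q ≤ rigidityRank G p

/-- Two frameworks `(G, p)` and `(G, q)` are *equivalent* if `f_G p = f_G q`. -/
def FrameworkEquivalent (p q : V → X) : Prop :=
  rigidityMap G X p = rigidityMap G X q

/-- A well-positioned framework is *strongly regular* if every framework equivalent to it is
regular. -/
def IsStronglyRegularPlacement (p : V → X) : Prop :=
  IsWellPositioned G p ∧ ∀ q : V → X, FrameworkEquivalent G p q → IsRegularPlacement G q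

/-- A placement of `V` is *completely regular* if it is a regular placement of every graph on
`V`. -/
def IsCompletelyRegularPlacement (p : V → X) : Prop :=
  ∀ H : SimpleGraph V, IsWellPositioned H p ∧ IsRegularPlacement H p

/-- A placement of `V` is *completely strongly regular* if it is a strongly regular placement of
every graph on `V`. -/
def IsCompletelyStronglyRegularPlacement (p : V → X) : Prop :=
  ∀ H : SimpleGraph V, IsWellPositioned H p ∧ IsStronglyRegularPlacement H p

end Frameworks

/-- The set `Reg(G; X)` of regular placements of `G` in `X`. -/
def regularPlacements {V : Type*} (G : SimpleGraph V) (X : Type*) [NormedAddCommGroup X]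
    [NormedSpace ℝ X] : Set (V → X) :=
  {p | IsRegularPlacement G p}

/-- The set `Str(G; X)` of strongly regular placements of `G` in `X`. -/
def stronglyRegularPlacements {V : Type*} (G : SimpleGraph V) (X : Type*) [NormedAddCommGroup X]
    [NormedSpace ℝ X] : Set (V → X) :=
  {p | IsStronglyRegularPlacement G p}

/-- The set `Com(V; X)` of completely regular placements of `V` in `X`. -/
def completelyRegularPlacements (V X : Type*) [NormedAddCommGroup X] [NormedSpace ℝ X] :
    Set (V → X) :=
  {p | IsCompletelyRegularPlacement p}

/-- The set `ComStr(V; X)` of completely strongly regular placements of `V` in `X`. -/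
def completelyStronglyRegularPlacements (V X : Type*) [NormedAddCommGroup X] [NormedSpace ℝ X] :
    Set (V → X) :=
  {p | IsCompletelyStronglyRegularPlacement p}

/-- A subset `S` of a finite-dimensional real vector space `W` is *conull* if its complement has
Lebesgue measure zero. Lebesgue measure, transported to `W` by a choice of basis, is a Haar measure,
and all Haar measures on `W` have the same null sets. -/
def IsConullSet {W : Type*} [AddCommGroup W] [TopologicalSpace W] [MeasurableSpace W] [BorelSpace W]
    (S : Set W) : Prop :=
  ∀ μ : Measure W, μ.IsAddHaarMeasure → μ Sᶜ = 0

end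

/-! Let P be the set of placements with no collapsed edge. It is open and conull, f_G is analytic on
it, and it is exactly the set of well-positioned placements. On P the rank of df_G(p) is the largest
n such that some n edges give a partial rigidity map that is a submersion at p. Everything is
phrased through these finitely indexed partial maps.

Regular placements: surjectivity of the derivative is an open condition, so the rank cannot drop
locally and Reg is open. If n edges give a submersion at one q in P, then when dim X > 1 a
determinant that is nonzero at q is analytic on P. Almost every p in P is joined to q by a segment
inside P, so the identity theorem and the nullity of zero sets of analytic functions show that the
same edges give a submersion at almost every p. When dim X = 1 the rank is constant on P
(`exists_rigidityOperator_eq_mul_of_finrank_eq_one`).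

Strongly regular placements: the complement of Str is closed by compactness, since a non-regular
equivalent placement can be translated component by component until it is bounded in terms of p. If
p is regular but equivalent to a non-regular q, choose edges giving a submersion at p of maximal
rank; the partial map is critical at q and takes the same value at p. So p lies in the preimage,
under a submersion, of a set of critical values, which is null by Sard. The analytic form of Sard
holds in all dimensions without Taylor estimates, as an analytic derivative vanishing at a point to
infinite order vanishes nearby.

The two complete versions are finite intersections over the graphs on V. -/

open scoped Topology

/-! ### Analytic submersions and null sets -/

/-- Local normal form of an analytic submersion, with analytic inverse chart. -/
theorem AnalyticAt.exists_straightening {E G : Type*} [NormedAddCommGroup E] [NormedSpace ℝ E]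
    [FiniteDimensional ℝ E] [NormedAddCommGroup G] [NormedSpace ℝ G] [FiniteDimensional ℝ G]
    {f : E → G} {x : E} (hf : AnalyticAt ℝ f x) (hs : Function.Surjective (fderiv ℝ f x)) :
    ∃ (K : Submodule ℝ E) (e : OpenPartialHomeomorph E (G × K)),
      Module.finrank ℝ G + Module.finrank ℝ K = Module.finrank ℝ E ∧ x ∈ e.source ∧
      (∀ y, (e y).1 = f y) ∧ AnalyticOnNhd ℝ e.symm e.target := by
  have := FiniteDimensional.complete ℝ E
  have := FiniteDimensional.complete ℝ G
  have hf' : HasStrictFDerivAt f (fderiv ℝ f x) x := hf.hasStrictFDerivAt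
  have hr : (fderiv ℝ f x).range = ⊤ := LinearMap.range_eq_top.2 hs
  let φ := hf'.implicitFunctionDataOfComplemented f (fderiv ℝ f x) hr
    (fderiv ℝ f x).ker_closedComplemented_of_finiteDimensional_range
  let e := φ.toOpenPartialHomeomorph
  have hx : x ∈ e.source := φ.pt_mem_toOpenPartialHomeomorph_source
  have han : AnalyticAt ℝ e x := by
    change AnalyticAt ℝ (fun y => (f y, φ.rightDeriv (y - x))) x
    exact hf.prod ((φ.rightDeriv.analyticAt _).comp (analyticAt_id.sub analyticAt_const))
  have hsymm : AnalyticAt ℝ e.symm (e x) := by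
    refine e.analyticAt_symm (e.map_source hx) (i := φ.leftDeriv.equivProdOfSurjectiveOfIsCompl
      φ.rightDeriv φ.range_leftDeriv φ.range_rightDeriv φ.isCompl_ker) ?_ ?_
    · rwa [e.left_inv hx]
    · rw [e.left_inv hx]
      exact φ.hasStrictFDerivAt.hasFDerivAt.fderiv
  -- The inverse chart is analytic at the image of `x`, hence on an open set around it; the chart is
  -- restricted to that set.
  let A : Set (G × (fderiv ℝ f x).ker) := {y | AnalyticAt ℝ e.symm y}
  have hA : IsOpen A := isOpen_analyticAt ℝ _
  refine ⟨_, (e.symm.restrOpen A hA).symm, ?_, ⟨?_, ?_⟩, fun y => rfl, ?_⟩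
  · rw [← (fderiv ℝ f x).toLinearMap.finrank_range_add_finrank_ker,
      LinearMap.range_eq_top.2 hs, finrank_top]
  · exact hx
  · exact hsymm
  · intro y hy
    exact hy.2

/-- Images of subsets of a second countable space are null as soon as they are locally null. -/
theorem measure_image_null_of_locally_null {α β : Type*} [TopologicalSpace α]
    [SecondCountableTopology α] [MeasurableSpace β] {μ : Measure β} {f : α → β} {s : Set α}
    (h : ∀ x ∈ s, ∃ t ∈ 𝓝 x, μ (f '' (t ∩ s)) = 0) : μ (f '' s) = 0 := by
  choose! t ht hμ using h
  obtain ⟨c, hcs, hc, hcov⟩ := TopologicalSpace.countable_cover_nhdsWithin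
    (f := t) (s := s) (fun x hx => mem_nhdsWithin_of_mem_nhds (ht x hx))
  have : f '' s ⊆ ⋃ x ∈ c, f '' (t x ∩ s) := by
    rintro _ ⟨y, hy, rfl⟩
    obtain ⟨x, hx, hyx⟩ := Set.mem_iUnion₂.1 (hcov hy)
    exact Set.mem_iUnion₂.2 ⟨x, hx, y, ⟨hyx, hy⟩, rfl⟩
  exact measure_mono_null this ((measure_biUnion_null_iff hc).2 fun x hx => hμ x (hcs hx))

/-- Preimages of null sets under submersions are null. -/
theorem measure_preimage_null_of_submersion {E G : Type*} [NormedAddCommGroup E] [NormedSpace ℝ E]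
    [FiniteDimensional ℝ E] [MeasurableSpace E] [BorelSpace E] [NormedAddCommGroup G]
    [NormedSpace ℝ G] [FiniteDimensional ℝ G] [MeasurableSpace G] [BorelSpace G]
    (μ : Measure E) [μ.IsAddHaarMeasure] (ν : Measure G) [ν.IsAddHaarMeasure]
    {f : E → G} {s : Set E} (hf : ∀ x ∈ s, AnalyticAt ℝ f x)
    (hs : ∀ x ∈ s, Function.Surjective (fderiv ℝ f x)) {A : Set G} (hA : ν A = 0) :
    μ (s ∩ f ⁻¹' A) = 0 := by
  refine measure_null_of_locally_null _ fun x hx => ?_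
  obtain ⟨K, e, hK, hxe, hfst, hsymm⟩ := (hf x hx.1).exists_straightening (hs x hx.1)
  refine ⟨_, mem_nhdsWithin_of_mem_nhds (e.open_source.mem_nhds hxe) |> fun h =>
    Filter.inter_mem h self_mem_nhdsWithin, ?_⟩
  -- A linear identification of `E` with `G × K` makes the straightening a map from `E` to itself,
  -- so that differentiable images of null sets are null; any two Haar measures on `G × K` have the
  -- same null sets.
  have hdim : Module.finrank ℝ E = Module.finrank ℝ (G × K) := by
    rw [Module.finrank_prod, hK]
  let T : E ≃L[ℝ] G × K := ContinuousLinearEquiv.ofFinrankEq hdim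
  let _ : MeasurableSpace K := borel K
  have : BorelSpace K := ⟨rfl⟩
  let κ : Measure K := Measure.addHaar
  have : (μ.map T).IsAddHaarMeasure := T.isAddHaarMeasure_map μ
  have hnull : μ (T ⁻¹' (A ×ˢ Set.univ)) = 0 := by
    have h1 : (ν.prod κ) (A ×ˢ (Set.univ : Set K)) = 0 := by
      rw [Measure.prod_prod, hA, zero_mul]
    have h2 : (μ.map T) (A ×ˢ (Set.univ : Set K)) = 0 :=
      Measure.absolutelyContinuous_isAddHaarMeasure (μ.map T) (ν.prod κ) h1
    exact (T.toHomeomorph.measurableEmbedding.map_apply μ _).symm.trans h2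
  have himg : e.source ∩ (s ∩ f ⁻¹' A) ⊆
      (fun z => e.symm (T z)) '' (T ⁻¹' (A ×ˢ Set.univ ∩ e.target)) := by
    rintro y ⟨hye, -, hyA⟩
    refine ⟨T.symm (e y), ?_, ?_⟩
    · simp only [Set.mem_preimage, ContinuousLinearEquiv.apply_symm_apply]
      refine ⟨⟨?_, trivial⟩, e.map_source hye⟩
      rw [hfst]; exact hyA
    · simp only [ContinuousLinearEquiv.apply_symm_apply]
      exact e.left_inv hye
  refine measure_mono_null himg
    (addHaar_image_eq_zero_of_differentiableOn_of_addHaar_eq_zero μ ?_ ?_)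
  · intro z hz
    exact ((hsymm _ hz.2).differentiableAt.comp z T.differentiableAt).differentiableWithinAt
  · exact measure_mono_null (Set.preimage_mono Set.inter_subset_left) hnull

/-! ### Zero sets of analytic functions -/

/-- An analytic function vanishing at `x` but not near `x` has an iterated derivative which vanishes
at `x` to first order. -/
theorem AnalyticAt.exists_iteratedFDeriv_eq_zero_fderiv_ne_zero {E H : Type*}
    [NormedAddCommGroup E] [NormedSpace ℝ E] [NormedAddCommGroup H] [NormedSpace ℝ H]
    [CompleteSpace H] {g : E → H} {x : E} (hg : AnalyticAt ℝ g x) (h0 : g x = 0)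
    (hne : ¬ g =ᶠ[𝓝 x] 0) :
    ∃ i : ℕ, iteratedFDeriv ℝ i g x = 0 ∧ fderiv ℝ (iteratedFDeriv ℝ i g) x ≠ 0 := by
  by_contra! hcon
  have hall : ∀ i, iteratedFDeriv ℝ i g x = 0 := by
    intro i
    induction i with
    | zero => ext; simp [h0]
    | succ i ih =>
      ext v
      rw [iteratedFDeriv_succ_apply_left, hcon i ih]
      rfl
  obtain ⟨p, r, hp⟩ := hg
  apply hne
  filter_upwards [Metric.eball_mem_nhds x hp.r_pos] with y hy
  have := hp.hasSum_iteratedFDeriv (y := y - x) (by simpa [edist_eq_enorm_sub] using hy)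
  simp only [hall, zero_apply, smul_zero, add_sub_cancel] at this
  exact this.unique hasSum_zero

theorem exists_functional_comp_fderiv_ne_zero {E H : Type*}
    [NormedAddCommGroup E] [NormedSpace ℝ E] [NormedAddCommGroup H] [NormedSpace ℝ H]
    {h : E → H} {x : E} (hd : DifferentiableAt ℝ h x) (hne : fderiv ℝ h x ≠ 0) :
    ∃ l : H →L[ℝ] ℝ, Function.Surjective (fderiv ℝ (fun y => l (h y)) x) := by
  obtain ⟨u, hu⟩ : ∃ u, fderiv ℝ h x u ≠ 0 := by
    by_contra! hcon
    exact hne (ContinuousLinearMap.ext hcon)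
  obtain ⟨l, hl⟩ := SeparatingDual.exists_ne_zero (R := ℝ) hu
  refine ⟨l, ?_⟩
  have : fderiv ℝ (fun y => l (h y)) x = l.comp (fderiv ℝ h x) :=
    (l.hasFDerivAt.comp x hd.hasFDerivAt).fderiv
  rw [this]
  exact LinearMap.surjective (f := (l.comp (fderiv ℝ h x) : E →ₗ[ℝ] ℝ)) (fun h0 => hl (by
    simpa using LinearMap.congr_fun h0 u))

/-- The zero set of an analytic function is null away from the points near which the function
vanishes identically. -/
theorem measure_zeros_analytic_eq_zero {E : Type*} [NormedAddCommGroup E] [NormedSpace ℝ E]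
    [FiniteDimensional ℝ E] [MeasurableSpace E] [BorelSpace E] (μ : Measure E)
    [μ.IsAddHaarMeasure] {H : Type*} [NormedAddCommGroup H] [NormedSpace ℝ H] [CompleteSpace H]
    {g : E → H} {s : Set E} (hg : AnalyticOnNhd ℝ g s) (hne : ∀ x ∈ s, ¬ g =ᶠ[𝓝 x] 0) :
    μ {x ∈ s | g x = 0} = 0 := by
  have hsub : {x ∈ s | g x = 0} ⊆ ⋃ i : ℕ, {x ∈ s | iteratedFDeriv ℝ i g x = 0 ∧
      fderiv ℝ (iteratedFDeriv ℝ i g) x ≠ 0} := by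
    rintro x ⟨hx, h0⟩
    obtain ⟨i, hi⟩ := (hg x hx).exists_iteratedFDeriv_eq_zero_fderiv_ne_zero h0 (hne x hx)
    exact Set.mem_iUnion.2 ⟨i, hx, hi⟩
  refine measure_mono_null hsub (measure_iUnion_null fun i => ?_)
  refine measure_null_of_locally_null _ fun x hx => ?_
  have hgi := hg.iteratedFDeriv i
  obtain ⟨l, hl⟩ := exists_functional_comp_fderiv_ne_zero (hgi x hx.1).differentiableAt hx.2.2
  set w : E → ℝ := fun y => l (iteratedFDeriv ℝ i g y)
  have hw : AnalyticAt ℝ w x := (l.analyticAt _).comp (hgi x hx.1)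
  have hev : ∀ᶠ y in 𝓝 x, AnalyticAt ℝ w y ∧ fderiv ℝ w y ≠ 0 := by
    refine hw.eventually_analyticAt.and (hw.fderiv.continuousAt.eventually_ne ?_)
    intro h0
    obtain ⟨u, hu⟩ := hl 1
    simp [h0] at hu
  refine ⟨_, Filter.inter_mem (mem_nhdsWithin_of_mem_nhds hev) self_mem_nhdsWithin, ?_⟩
  -- Near `x` the stratum lies in the hypersurface `w = 0`, the preimage of a null point under a
  -- submersion.
  refine measure_mono_null ?_ (measure_preimage_null_of_submersion μ volume
    (s := {y | AnalyticAt ℝ w y ∧ fderiv ℝ w y ≠ 0}) (f := w) (A := {0}) (fun y hy => hy.1)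
    (fun y hy => ?_) (by simp))
  · rintro y ⟨hy, hys⟩
    exact ⟨hy, by simp [w, hys.2.1]⟩
  · exact LinearMap.surjective (f := (fderiv ℝ w y : E →ₗ[ℝ] ℝ)) (fun h0 => hy.2 (by
      ext u; simpa using LinearMap.congr_fun h0 u))

/-! ### Sard's theorem -/

theorem isOpen_setOf_surjective_continuousLinearMap {E F : Type*} [NormedAddCommGroup E]
    [NormedSpace ℝ E] [NormedAddCommGroup F] [NormedSpace ℝ F] [FiniteDimensional ℝ F] :
    IsOpen {A : E →L[ℝ] F | Function.Surjective A} := by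
  convert isOpen_setOfPred_nat_le_rank (𝕜 := ℝ) (E := E) (F := F) (Module.finrank ℝ F) using 1
  ext A
  simp only [Set.mem_ofPred_eq]
  rw [LinearMap.rank, ← Module.finrank_eq_rank, Nat.cast_le]
  constructor
  · intro h
    have : (A : E →ₗ[ℝ] F).range = ⊤ := LinearMap.range_eq_top.2 h
    rw [this, finrank_top]
  · intro h
    have : (A : E →ₗ[ℝ] F).range = ⊤ :=
      Submodule.eq_top_of_finrank_eq (le_antisymm (Submodule.finrank_le _) h)
    exact LinearMap.range_eq_top.1 this

/-- One step of the induction for Sard's theorem: near a point of the zero set of `w`, where `w` is a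
submersion, the critical points in `{w = 0}` are critical points of the restriction to `{w = 0}`. -/
theorem measure_image_critical_zeros_eq_zero {E : Type*} [NormedAddCommGroup E] [NormedSpace ℝ E]
    [FiniteDimensional ℝ E] {F : Type*} [NormedAddCommGroup F] [NormedSpace ℝ F]
    [MeasurableSpace F] (ν : Measure F)
    {f : E → F} {U : Set E} (hU : IsOpen U) (hf : AnalyticOnNhd ℝ f U)
    (ih : ∀ (K : Submodule ℝ E) (g : K → F) (W : Set K),
      Module.finrank ℝ K < Module.finrank ℝ E → IsOpen W → AnalyticOnNhd ℝ g W →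
      ν (g '' {y ∈ W | ¬ Function.Surjective (fderiv ℝ g y)}) = 0)
    {w : E → ℝ} {x : E} (hw : AnalyticAt ℝ w x) (hs : Function.Surjective (fderiv ℝ w x)) :
    ∃ t ∈ 𝓝 x, ν (f '' (t ∩ {z ∈ U | w z = 0 ∧ ¬ Function.Surjective (fderiv ℝ f z)})) = 0 := by
  obtain ⟨K, e, hK, hxe, hfst, hsymm⟩ := hw.exists_straightening hs
  rw [Module.finrank_self] at hK
  refine ⟨e.source, e.open_source.mem_nhds hxe, ?_⟩
  let ψ : K → E := fun y => e.symm (0, y)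
  have hι : Continuous fun y : K => ((0, y) : ℝ × K) := by fun_prop
  have hψ : AnalyticOnNhd ℝ ψ ((fun y : K => ((0, y) : ℝ × K)) ⁻¹' e.target) := fun y hy =>
    (hsymm _ hy).comp (f := fun y : K => ((0, y) : ℝ × K)) (analyticAt_const.prod analyticAt_id)
  let W : Set K := (fun y : K => ((0, y) : ℝ × K)) ⁻¹' (e.target ∩ e.symm ⁻¹' U)
  have hW : IsOpen W := (e.isOpen_inter_preimage_symm hU).preimage hι
  have hg : AnalyticOnNhd ℝ (fun y => f (ψ y)) W := fun y hy =>
    AnalyticAt.comp (f := ψ) (hf _ hy.2) (hψ y hy.1)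
  refine measure_mono_null ?_ (ih K (fun y => f (ψ y)) W (by omega) hW hg)
  rintro _ ⟨z, ⟨hze, hzU, hwz, hcrit⟩, rfl⟩
  have hez : ((0 : ℝ), (e z).2) = e z := by rw [← hwz, ← hfst]
  have hψz : ψ (e z).2 = z := by
    change e.symm (0, (e z).2) = z
    rw [hez, e.left_inv hze]
  have hmem : (e z).2 ∈ W := by
    change (0, (e z).2) ∈ e.target ∧ e.symm (0, (e z).2) ∈ U
    rw [hez, e.left_inv hze]
    exact ⟨e.map_source hze, hzU⟩
  refine ⟨(e z).2, ⟨hmem, fun hsurj => hcrit ?_⟩, congrArg f hψz⟩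
  have hd : fderiv ℝ (fun y => f (ψ y)) (e z).2 =
      (fderiv ℝ f (ψ (e z).2)).comp (fderiv ℝ ψ (e z).2) :=
    fderiv_comp _ (hf _ hmem.2).differentiableAt (hψ _ hmem.1).differentiableAt
  rw [hd, hψz, ContinuousLinearMap.coe_comp] at hsurj
  exact hsurj.of_comp

/-- The other step of the induction for Sard's theorem: points at which the derivative does not
vanish, by slicing the target along a coordinate. -/
theorem volume_image_critical_of_coord_submersion {E : Type*} [NormedAddCommGroup E]
    [NormedSpace ℝ E] [FiniteDimensional ℝ E] {k : ℕ}
    {f : E → Fin (k + 1) → ℝ} {U : Set E} (hU : IsOpen U) (hf : AnalyticOnNhd ℝ f U)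
    (ih : ∀ (K : Submodule ℝ E) (g : K → Fin k → ℝ) (W : Set K),
      Module.finrank ℝ K < Module.finrank ℝ E → IsOpen W → AnalyticOnNhd ℝ g W →
      volume (g '' {y ∈ W | ¬ Function.Surjective (fderiv ℝ g y)}) = 0)
    {i : Fin (k + 1)} {x : E} (hx : x ∈ U) (hs : Function.Surjective (fderiv ℝ (fun z => f z i) x)) :
    ∃ t ∈ 𝓝 x, volume (f '' (t ∩ {z ∈ U | ¬ Function.Surjective (fderiv ℝ f z)})) = 0 := by
  set w : E → ℝ := fun z => f z i with hwdef
  have hw : AnalyticOnNhd ℝ w U := fun z hz =>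
    ((ContinuousLinearMap.proj (R := ℝ) (φ := fun _ : Fin (k + 1) => ℝ) i).analyticAt _).comp
      (hf z hz)
  obtain ⟨K, e, hK, hxe, hfst, hsymm⟩ := (hw x hx).exists_straightening hs
  rw [Module.finrank_self] at hK
  have hev : {z | z ∈ e.source ∧ z ∈ U ∧ Function.Surjective (fderiv ℝ w z)} ∈ 𝓝 x := by
    refine Filter.inter_mem (e.open_source.mem_nhds hxe)
      (Filter.inter_mem (hU.mem_nhds hx) ?_)
    exact (hw x hx).fderiv.continuousAt
      (isOpen_setOf_surjective_continuousLinearMap.mem_nhds hs)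
  -- On a compact neighbourhood the critical image is compact, hence measurable, as Fubini requires.
  obtain ⟨t, ht, htsub, htc⟩ := local_compact_nhds hev
  refine ⟨t, ht, ?_⟩
  have htU : t ⊆ U := fun z hz => (htsub hz).2.1
  have hcomp : IsCompact (t ∩ {z ∈ U | ¬ Function.Surjective (fderiv ℝ f z)}) := by
    have hc : ContinuousOn (fderiv ℝ f) t := fun z hz =>
      (hf z (htU hz)).fderiv.continuousAt.continuousWithinAt
    have hcl := hc.preimage_isClosed_of_isClosed htc.isClosed
      isOpen_setOf_surjective_continuousLinearMap.isClosed_compl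
    refine htc.of_isClosed_subset (s := t) (t := _) ?_ Set.inter_subset_left
    convert hcl using 1
    ext z
    constructor
    · rintro ⟨hz, -, h⟩; exact ⟨hz, h⟩
    · rintro ⟨hz, h⟩; exact ⟨hz, htU hz, h⟩
  have himg : IsCompact (f '' (t ∩ {z ∈ U | ¬ Function.Surjective (fderiv ℝ f z)})) :=
    hcomp.image_of_continuousOn fun z hz =>
      (hf z (htU hz.1)).continuousAt.continuousWithinAt
  set T := f '' (t ∩ {z ∈ U | ¬ Function.Surjective (fderiv ℝ f z)}) with hT
  let Φ := MeasurableEquiv.piFinSuccAbove (fun _ : Fin (k + 1) => ℝ) i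
  have hΦ : MeasurePreserving Φ := volume_preserving_piFinSuccAbove (fun _ => ℝ) i
  rw [← (hΦ.symm Φ).measure_preimage himg.measurableSet.nullMeasurableSet]
  change (volume.prod volume) _ = 0
  rw [Measure.measure_prod_null (Φ.symm.measurable himg.measurableSet)]
  refine Filter.Eventually.of_forall fun s => ?_
  let π : (Fin (k + 1) → ℝ) →L[ℝ] (Fin k → ℝ) :=
    ContinuousLinearMap.pi fun j => ContinuousLinearMap.proj (i.succAbove j)
  let ψ : K → E := fun y => e.symm (s, y)
  have hι : Continuous fun y : K => ((s, y) : ℝ × K) := by fun_prop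
  have hψ : AnalyticOnNhd ℝ ψ ((fun y : K => ((s, y) : ℝ × K)) ⁻¹' e.target) := fun y hy =>
    (hsymm _ hy).comp (f := fun y : K => ((s, y) : ℝ × K)) (analyticAt_const.prod analyticAt_id)
  let W : Set K := (fun y : K => ((s, y) : ℝ × K)) ⁻¹' (e.target ∩ e.symm ⁻¹' U)
  have hW : IsOpen W := (e.isOpen_inter_preimage_symm hU).preimage hι
  have hfψ : AnalyticOnNhd ℝ (fun y => f (ψ y)) W := fun y hy =>
    AnalyticAt.comp (f := ψ) (hf _ hy.2) (hψ y hy.1)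
  have hg : AnalyticOnNhd ℝ (fun y => π (f (ψ y))) W := fun y hy =>
    (π.analyticAt _).comp (hfψ y hy)
  refine measure_mono_null ?_ (ih K (fun y => π (f (ψ y))) W (by omega) hW hg)
  rintro v ⟨z, ⟨hzt, hzU, hcrit⟩, hzv⟩
  have hzv' : Φ (f z) = (s, v) := by rw [hzv, MeasurableEquiv.apply_symm_apply]
  have hws : w z = s := congrArg Prod.fst hzv'
  have hπv : π (f z) = v := congrArg Prod.snd hzv'
  have hze : z ∈ e.source := (htsub hzt).1
  have hez : (s, (e z).2) = e z := by rw [← hws, ← hfst]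
  have hψz : ψ (e z).2 = z := by
    change e.symm (s, (e z).2) = z
    rw [hez, e.left_inv hze]
  have hmem : (e z).2 ∈ W := by
    change (s, (e z).2) ∈ e.target ∧ e.symm (s, (e z).2) ∈ U
    rw [hez, e.left_inv hze]
    exact ⟨e.map_source hze, hzU⟩
  refine ⟨(e z).2, ⟨hmem, fun hsurj => hcrit ?_⟩, by rw [← hπv]; exact congrArg (fun a => π (f a)) hψz⟩
  have hd : HasFDerivAt (fun y => f (ψ y)) ((fderiv ℝ f z).comp (fderiv ℝ ψ (e z).2)) (e z).2 := by
    have h1 : HasFDerivAt f (fderiv ℝ f z) (ψ (e z).2) := by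
      rw [hψz]; exact (hf z hzU).differentiableAt.hasFDerivAt
    exact h1.comp _ (hψ _ hmem.1).differentiableAt.hasFDerivAt
  have hdπ := (π.hasFDerivAt.comp _ hd).fderiv
  have hfw : ∀ u, fderiv ℝ w z u = fderiv ℝ f z u i := by
    intro u
    have := ((ContinuousLinearMap.proj (R := ℝ) (φ := fun _ : Fin (k + 1) => ℝ) i).hasFDerivAt.comp
      z (hf z hzU).differentiableAt.hasFDerivAt).fderiv
    exact congrArg (fun L => L u) this
  have hzero : ∀ y', fderiv ℝ f z (fderiv ℝ ψ (e z).2 y') i = 0 := by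
    intro y'
    have h1 := ((ContinuousLinearMap.proj (R := ℝ) (φ := fun _ : Fin (k + 1) => ℝ) i).hasFDerivAt.comp
      _ hd)
    have h2 : HasFDerivAt (fun y => f (ψ y) i) (0 : K →L[ℝ] ℝ) (e z).2 := by
      refine (hasFDerivAt_const s _).congr_of_eventuallyEq ?_
      filter_upwards [hW.mem_nhds hmem] with y hy
      change w (e.symm (s, y)) = s
      rw [← hfst, e.right_inv hy.1]
    exact congrArg (fun L => L y') (h1.unique h2)
  -- To hit `c`, a multiple of `b` (where the `i`-th component of the derivative is 1) supplies
  -- coordinate `i`; directions along the slice leave that coordinate alone and supply the others.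
  obtain ⟨b, hb⟩ := (htsub hzt).2.2 1
  intro c
  have hsurj' : Function.Surjective (fderiv ℝ (fun y => π (f (ψ y))) (e z).2) := hsurj
  obtain ⟨y', hy'⟩ := hsurj' (π (c - c i • fderiv ℝ f z b))
  have hy2 : π (fderiv ℝ f z (fderiv ℝ ψ (e z).2 y')) = π (c - c i • fderiv ℝ f z b) := by
    rw [← hy']
    exact (congrArg (fun L => L y') hdπ).symm
  refine ⟨fderiv ℝ ψ (e z).2 y' + c i • b, ?_⟩
  rw [map_add, map_smul]
  ext j
  rcases Fin.eq_self_or_eq_succAbove i j with rfl | ⟨j, rfl⟩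
  · have := hfw b
    rw [hb] at this
    simp [hzero y', ← this]
  · have := congrFun hy2 j
    simp only [π, ContinuousLinearMap.coe_pi', ContinuousLinearMap.proj_apply, Pi.sub_apply,
      Pi.smul_apply, smul_eq_mul] at this
    simp [this]

/-- **Sard's theorem** for real analytic maps. -/
theorem AnalyticOnNhd.volume_image_critical_eq_zero {E : Type*} [NormedAddCommGroup E]
    [NormedSpace ℝ E] [FiniteDimensional ℝ E] {m : ℕ} {f : E → Fin m → ℝ} {U : Set E}
    (hU : IsOpen U) (hf : AnalyticOnNhd ℝ f U) :
    volume (f '' {z ∈ U | ¬ Function.Surjective (fderiv ℝ f z)}) = 0 := by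
  induction hn : Module.finrank ℝ E using Nat.strong_induction_on generalizing E m with
  | _ n IH =>
  subst hn
  cases m with
  | zero =>
    convert measure_empty (μ := (volume : Measure (Fin 0 → ℝ)))
    rw [Set.image_eq_empty]
    ext z
    simp only [Set.mem_ofPred_eq, Set.mem_empty_iff_false, iff_false, not_and, not_not]
    exact fun _ c => ⟨0, Subsingleton.elim _ _⟩
  | succ k =>
  set C := {z ∈ U | ¬ Function.Surjective (fderiv ℝ f z)} with hC
  have hdf := hf.fderiv
  -- Three kinds of critical points: nonzero derivative (slice the target), derivative zero nearby
  -- (`f` is locally constant), derivative vanishing to finite order (the points lie on a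
  -- hypersurface, of smaller dimension).
  have hsub : C ⊆ {z ∈ C | fderiv ℝ f z ≠ 0} ∪ {z ∈ C | fderiv ℝ f =ᶠ[𝓝 z] 0} ∪
      ⋃ i : ℕ, {z ∈ C | iteratedFDeriv ℝ i (fderiv ℝ f) z = 0 ∧
        fderiv ℝ (iteratedFDeriv ℝ i (fderiv ℝ f)) z ≠ 0} := by
    intro z hz
    by_cases h0 : fderiv ℝ f z = 0
    · by_cases h1 : fderiv ℝ f =ᶠ[𝓝 z] 0
      · exact Or.inl (Or.inr ⟨hz, h1⟩)
      · obtain ⟨i, hi⟩ := (hdf z hz.1).exists_iteratedFDeriv_eq_zero_fderiv_ne_zero h0 h1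
        exact Or.inr (Set.mem_iUnion.2 ⟨i, hz, hi⟩)
    · exact Or.inl (Or.inl ⟨hz, h0⟩)
  refine measure_mono_null (Set.image_mono hsub) ?_
  rw [Set.image_union, Set.image_union, Set.image_iUnion]
  refine measure_union_null (measure_union_null ?_ ?_) (measure_iUnion_null fun i => ?_)
  · refine measure_image_null_of_locally_null fun x hx => ?_
    obtain ⟨i, hi⟩ : ∃ i, Function.Surjective (fderiv ℝ (fun z => f z i) x) := by
      obtain ⟨u, hu⟩ : ∃ u, fderiv ℝ f x u ≠ 0 := by
        by_contra! hcon
        exact hx.2 (ContinuousLinearMap.ext hcon)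
      obtain ⟨i, hi⟩ := Function.ne_iff.1 hu
      refine ⟨i, LinearMap.surjective (f := (fderiv ℝ (fun z => f z i) x : E →ₗ[ℝ] ℝ))
        fun h0 => hi ?_⟩
      have := ((ContinuousLinearMap.proj (R := ℝ) (φ := fun _ : Fin (k + 1) => ℝ)
        i).hasFDerivAt.comp x (hf x hx.1.1).differentiableAt.hasFDerivAt).fderiv
      exact (congrArg (fun L => L u) this).symm.trans (LinearMap.congr_fun h0 u)
    obtain ⟨t, ht, hvol⟩ := volume_image_critical_of_coord_submersion hU hf
      (fun K g W hK hW hg => IH _ hK hW hg rfl) hx.1.1 hi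
    exact ⟨t, ht, measure_mono_null (Set.image_mono (Set.inter_subset_inter_right _
      fun z hz => hz.1)) hvol⟩
  · refine measure_image_null_of_locally_null fun x hx => ?_
    obtain ⟨r, hr, hball⟩ := Metric.eventually_nhds_iff_ball.1
      (hx.2.and (hU.mem_nhds hx.1.1))
    refine ⟨Metric.ball x r, Metric.ball_mem_nhds x hr,
      measure_mono_null (t := {f x}) ?_ (measure_singleton _)⟩
    rintro _ ⟨y, ⟨hy, -⟩, rfl⟩
    refine (convex_ball x r).is_const_of_fderivWithin_eq_zero (𝕜 := ℝ)
      (fun z hz => (hf z (hball z hz).2).differentiableAt.differentiableWithinAt)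
      (fun z hz => ?_) hy (Metric.mem_ball_self hr)
    rw [fderivWithin_of_isOpen Metric.isOpen_ball hz]
    exact (hball z hz).1
  · refine measure_image_null_of_locally_null fun x hx => ?_
    have hgi := hdf.iteratedFDeriv i
    obtain ⟨l, hl⟩ := exists_functional_comp_fderiv_ne_zero (hgi x hx.1.1).differentiableAt hx.2.2
    have hw : AnalyticAt ℝ (fun y => l (iteratedFDeriv ℝ i (fderiv ℝ f) y)) x :=
      (l.analyticAt _).comp (hgi x hx.1.1)
    obtain ⟨t, ht, hvol⟩ := measure_image_critical_zeros_eq_zero volume hU hf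
      (fun K g W hK hW hg => IH _ hK hW hg rfl) hw hl
    refine ⟨t, ht, measure_mono_null (Set.image_mono ?_) hvol⟩
    rintro z ⟨hzt, hz⟩
    refine ⟨hzt, hz.1.1, ?_, hz.1.2⟩
    rw [hz.2.1, map_zero]

/-! ### Rank through coordinates -/

/-- Restriction of a vector of reals to a family of coordinates. -/
def coordRestrict {ι : Type*} {n : ℕ} (a : Fin n → ι) : (ι → ℝ) →L[ℝ] (Fin n → ℝ) :=
  ContinuousLinearMap.pi fun i => ContinuousLinearMap.proj (a i)

@[simp]
theorem coordRestrict_apply {ι : Type*} {n : ℕ} (a : Fin n → ι) (x : ι → ℝ) (i : Fin n) :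
    coordRestrict a x i = x (a i) := rfl

theorem le_finrank_range_of_coordRestrict_surjective {ι W : Type*} [Finite ι] [AddCommGroup W]
    [Module ℝ W] {n : ℕ} {L : W →ₗ[ℝ] (ι → ℝ)} {a : Fin n → ι}
    (h : Function.Surjective fun w => coordRestrict a (L w)) :
    n ≤ Module.finrank ℝ (LinearMap.range L) := by
  have hs : Function.Surjective
      ((coordRestrict a : (ι → ℝ) →ₗ[ℝ] (Fin n → ℝ)).domRestrict (LinearMap.range L)) := by
    intro c
    obtain ⟨w, hw⟩ := h c
    exact ⟨⟨L w, w, rfl⟩, hw⟩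
  simpa using LinearMap.finrank_le_finrank_of_surjective hs

/-- Take a maximal set of coordinates whose values can be prescribed freely. If some `L w` vanished
on it but not at `e`, multiples of `w` would allow `e` to be added; so the range restricts
bijectively to these coordinates. -/
theorem exists_coordRestrict_surjective {ι W : Type*} [Finite ι] [AddCommGroup W] [Module ℝ W]
    (L : W →ₗ[ℝ] (ι → ℝ)) :
    ∃ a : Fin (Module.finrank ℝ (LinearMap.range L)) → ι,
      Function.Surjective fun w => coordRestrict a (L w) := by
  classical
  let Q : Finset ι → Prop := fun s => ∀ c : ι → ℝ, ∃ w, ∀ e ∈ s, L w e = c e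
  have hfin : {s | Q s}.Finite := Set.toFinite _
  obtain ⟨s, hs, hmax⟩ := hfin.exists_maximalFor (fun s => s.card) _ ⟨∅, fun c => ⟨0, by simp⟩⟩
  have hQ : ∀ c : ι → ℝ, ∃ w, ∀ e ∈ s, L w e = c e := hs
  have hinj : ∀ w, (∀ e ∈ s, L w e = 0) → L w = 0 := by
    intro w hw
    by_contra hne
    obtain ⟨e, he⟩ := Function.ne_iff.1 hne
    rw [Pi.zero_apply] at he
    have hes : e ∉ s := fun h => he (hw e h)
    have hins : Q (insert e s) := by
      intro c
      obtain ⟨z, hz⟩ := hQ c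
      refine ⟨z + ((c e - L z e) / L w e) • w, fun e' he' => ?_⟩
      rcases Finset.mem_insert.1 he' with rfl | he'
      · simp [div_mul_cancel₀ _ he]
      · simp [hz e' he', hw e' he']
    have := hmax hins (by simp [Finset.card_insert_of_notMem hes])
    simp [Finset.card_insert_of_notMem hes] at this
  let R : LinearMap.range L →ₗ[ℝ] (s → ℝ) :=
    (LinearMap.funLeft ℝ ℝ (fun e : s => (e : ι))).domRestrict (LinearMap.range L)
  have hR : Function.Bijective R := by
    constructor
    · rw [← LinearMap.ker_eq_bot, LinearMap.ker_eq_bot']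
      rintro ⟨_, w, rfl⟩ h0
      exact Subtype.ext (hinj w fun e he => congrFun h0 ⟨e, he⟩)
    · intro c
      obtain ⟨w, hw⟩ := hQ fun e => if h : e ∈ s then c ⟨e, h⟩ else 0
      refine ⟨⟨L w, w, rfl⟩, funext fun e => ?_⟩
      have := hw e e.2
      simp only [e.2, dif_pos] at this
      exact this
  have hcard : s.card = Module.finrank ℝ (LinearMap.range L) := by
    rw [(LinearEquiv.ofBijective R hR).finrank_eq]; simp
  rw [← hcard]
  refine ⟨fun i => s.equivFin.symm i, fun c => ?_⟩
  obtain ⟨w, hw⟩ := hQ fun e => if h : e ∈ s then c (s.equivFin ⟨e, h⟩) else 0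
  refine ⟨w, funext fun i => ?_⟩
  have := hw _ (s.equivFin.symm i).2
  simp only [(s.equivFin.symm i).2, dif_pos] at this
  change L w ↑(s.equivFin.symm i) = c i
  rw [this]
  simp

/-! ### The rigidity map on well-positioned placements -/

section Frameworks

variable {V : Type*} {G : SimpleGraph V} {X : Type*} [NormedAddCommGroup X]

theorem continuous_rigidityMap : Continuous (rigidityMap G X) := by
  refine continuous_pi fun e => ?_
  obtain ⟨⟨v, w⟩, h⟩ := e
  change Continuous fun p : V → X => 1 / 2 * ‖p v - p w‖ ^ 2
  fun_prop

theorem rigidityMap_eq_iff {p q : V → X} : rigidityMap G X p = rigidityMap G X q ↔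
    ∀ v w, G.Adj v w → ‖p v - p w‖ = ‖q v - q w‖ := by
  constructor
  · intro h v w hvw
    have := congrFun h ⟨s(v, w), hvw⟩
    change 1 / 2 * ‖p v - p w‖ ^ 2 = 1 / 2 * ‖q v - q w‖ ^ 2 at this
    exact (pow_left_inj₀ (norm_nonneg _) (norm_nonneg _) two_ne_zero).1 (by linarith)
  · intro h
    funext e
    obtain ⟨⟨v, w⟩, hvw⟩ := e
    change 1 / 2 * ‖p v - p w‖ ^ 2 = 1 / 2 * ‖q v - q w‖ ^ 2
    rw [h v w hvw]

variable (G X) in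
/-- The placements of `G` with distinct end points of edges. -/
def edgeInjectivePlacements : Set (V → X) := {p | ∀ v w : V, G.Adj v w → p v ≠ p w}

theorem edgeInjectivePlacements_congr {p q : V → X} (h : rigidityMap G X p = rigidityMap G X q)
    (hq : q ∈ edgeInjectivePlacements G X) : p ∈ edgeInjectivePlacements G X := by
  intro v w hvw hp
  have := rigidityMap_eq_iff.1 h v w hvw
  rw [hp, sub_self, norm_zero] at this
  exact hq v w hvw (sub_eq_zero.1 (norm_eq_zero.1 this.symm))

theorem isOpen_edgeInjectivePlacements [Finite V] : IsOpen (edgeInjectivePlacements G X) := by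
  have : edgeInjectivePlacements G X = ⋂ (v : V) (w : V) (_ : G.Adj v w), {p | p v ≠ p w} := by
    ext p; simp [edgeInjectivePlacements]
  rw [this]
  exact isOpen_iInter_of_finite fun v => isOpen_iInter_of_finite fun w =>
    isOpen_iInter_of_finite fun _ => isOpen_ne_fun (continuous_apply v) (continuous_apply w)

theorem rigidityMap_sub_const {t : V → X} (ht : ∀ v w, G.Adj v w → t v = t w) (p : V → X) :
    rigidityMap G X (p - t) = rigidityMap G X p := by
  rw [rigidityMap_eq_iff]
  intro v w hvw
  simp only [Pi.sub_apply, ht v w hvw, sub_sub_sub_cancel_right]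

/-- Edge lengths of `q` are those of `p`, hence at most `2 * ‖p‖`; sum them along a walk. -/
theorem exists_norm_sub_le_of_reachable [Fintype V] {v w : V} (h : G.Reachable v w) :
    ∃ K : ℝ, 0 ≤ K ∧ ∀ p q : V → X, rigidityMap G X p = rigidityMap G X q →
      ‖q v - q w‖ ≤ K * ‖p‖ := by
  obtain ⟨c⟩ := h
  induction c with
  | nil => exact ⟨0, le_rfl, fun p q _ => by simp⟩
  | @cons u v w huv c ih =>
    obtain ⟨K, hK, h⟩ := ih
    refine ⟨2 + K, by positivity, fun p q hpq => ?_⟩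
    have h1 : ‖q u - q v‖ ≤ 2 * ‖p‖ := by
      rw [← rigidityMap_eq_iff.1 hpq u v huv]
      have := norm_sub_le (p u) (p v)
      have := norm_le_pi_norm p u
      have := norm_le_pi_norm p v
      linarith
    have h2 := h p q hpq
    have h3 : q u - q w = (q u - q v) + (q v - q w) := by abel
    rw [h3]
    refine (norm_add_le _ _).trans ?_
    linarith

variable [NormedSpace ℝ X]

theorem mem_stronglyRegularPlacements_iff {p : V → X} : p ∈ stronglyRegularPlacements G X ↔
    ∀ q : V → X, rigidityMap G X p = rigidityMap G X q → IsRegularPlacement G q :=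
  ⟨fun h => h.2, fun h => ⟨(h p rfl).1, h⟩⟩

variable [Fintype V] [Fintype G.edgeSet]

theorem analyticOnNhd_rigidityMap (hX : IsAnalyticNormedSpace X) :
    AnalyticOnNhd ℝ (rigidityMap G X) (edgeInjectivePlacements G X) := by
  intro p hp
  refine AnalyticAt.pi fun e => ?_
  obtain ⟨⟨v, w⟩, hvw⟩ := e
  change AnalyticAt ℝ (fun p : V → X => 1 / 2 * ‖p v - p w‖ ^ 2) p
  have hsub : AnalyticAt ℝ (fun p : V → X => p v - p w) p :=
    (ContinuousLinearMap.analyticAt (ContinuousLinearMap.proj (R := ℝ) (φ := fun _ : V => X) v -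
      ContinuousLinearMap.proj (R := ℝ) (φ := fun _ : V => X) w) p)
  have hnorm : AnalyticAt ℝ (fun p : V → X => ‖p v - p w‖) p :=
    AnalyticAt.comp (g := fun x : X => ‖x‖) (hX _ (sub_ne_zero.2 (hp v w hvw))) hsub
  exact analyticAt_const.mul (hnorm.pow 2)

theorem isWellPositioned_iff (hX : IsAnalyticNormedSpace X) {p : V → X} :
    IsWellPositioned G p ↔ p ∈ edgeInjectivePlacements G X :=
  ⟨fun h => h.2, fun h => ⟨(analyticOnNhd_rigidityMap hX p h).differentiableAt, h⟩⟩

variable (X) in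
/-- The rigidity map restricted to a family of edges. -/
noncomputable def partialRigidityMap {n : ℕ} (a : Fin n → G.edgeSet) (p : V → X) : Fin n → ℝ :=
  coordRestrict a (rigidityMap G X p)

theorem analyticOnNhd_partialRigidityMap (hX : IsAnalyticNormedSpace X) {n : ℕ}
    (a : Fin n → G.edgeSet) :
    AnalyticOnNhd ℝ (partialRigidityMap X a) (edgeInjectivePlacements G X) :=
  fun p hp => ((coordRestrict a).analyticAt _).comp (analyticOnNhd_rigidityMap hX p hp)

theorem fderiv_partialRigidityMap (hX : IsAnalyticNormedSpace X) {n : ℕ}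
    (a : Fin n → G.edgeSet) {p : V → X} (hp : p ∈ edgeInjectivePlacements G X) (u : V → X) :
    fderiv ℝ (partialRigidityMap X a) p u = coordRestrict a (rigidityOperator G p u) := by
  have := ((coordRestrict a).hasFDerivAt.comp p
    (analyticOnNhd_rigidityMap hX p hp).differentiableAt.hasFDerivAt).fderiv
  exact congrArg (fun L => L u) this

theorem le_rigidityRank (hX : IsAnalyticNormedSpace X) {n : ℕ}
    {a : Fin n → G.edgeSet} {p : V → X} (hp : p ∈ edgeInjectivePlacements G X)
    (h : Function.Surjective (fderiv ℝ (partialRigidityMap X a) p)) : n ≤ rigidityRank G p := by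
  refine le_finrank_range_of_coordRestrict_surjective (a := a) fun c => ?_
  obtain ⟨u, hu⟩ := h c
  exact ⟨u, by rw [← hu, fderiv_partialRigidityMap hX a hp]; rfl⟩

theorem exists_surjective_fderiv_partialRigidityMap (hX : IsAnalyticNormedSpace X) {p : V → X}
    (hp : p ∈ edgeInjectivePlacements G X) :
    ∃ a : Fin (rigidityRank G p) → G.edgeSet,
      Function.Surjective (fderiv ℝ (partialRigidityMap X a) p) := by
  obtain ⟨a, ha⟩ := exists_coordRestrict_surjective
    (rigidityOperator G p : (V → X) →ₗ[ℝ] (G.edgeSet → ℝ))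
  rw [rigidityRank]
  refine ⟨a, fun c => ?_⟩
  obtain ⟨u, hu⟩ := ha c
  exact ⟨u, (fderiv_partialRigidityMap hX a hp u).trans hu⟩

/-! ### Openness -/

theorem isOpen_regularPlacements (hX : IsAnalyticNormedSpace X) :
    IsOpen (regularPlacements G X) := by
  rw [isOpen_iff_mem_nhds]
  intro p hp
  have hpP := (isWellPositioned_iff hX).1 hp.1
  obtain ⟨a, ha⟩ := exists_surjective_fderiv_partialRigidityMap hX hpP
  filter_upwards [isOpen_edgeInjectivePlacements.mem_nhds hpP,
    (analyticOnNhd_partialRigidityMap hX a p hpP).fderiv.continuousAt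
      (isOpen_setOf_surjective_continuousLinearMap.mem_nhds ha)] with p' hp' ha'
  exact ⟨(isWellPositioned_iff hX).2 hp', fun q hq => (hp.2 q hq).trans (le_rigidityRank hX hp' ha')⟩

theorem rigidityRank_sub_const {t : V → X} (ht : ∀ v w, G.Adj v w → t v = t w) (p : V → X) :
    rigidityRank G (p - t) = rigidityRank G p := by
  have : rigidityOperator G (p - t) = rigidityOperator G p := by
    unfold rigidityOperator
    have h1 : (fun x => rigidityMap G X (x - t)) = rigidityMap G X :=
      funext (rigidityMap_sub_const ht)
    rw [← fderiv_comp_sub, h1]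
  rw [rigidityRank, this, rigidityRank]

theorem isRegularPlacement_of_sub_const (hX : IsAnalyticNormedSpace X) {t : V → X}
    (ht : ∀ v w, G.Adj v w → t v = t w) {p : V → X} (h : IsRegularPlacement G (p - t)) :
    IsRegularPlacement G p := by
  refine ⟨(isWellPositioned_iff hX).2 (edgeInjectivePlacements_congr
    (rigidityMap_sub_const ht p).symm ((isWellPositioned_iff hX).1 h.1)), ?_⟩
  rw [← rigidityRank_sub_const ht]
  exact h.2

/-- Translating each connected component separately changes neither edge lengths nor rank. Moving a
root of each component to the origin bounds every vertex by the walk estimate. -/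
theorem exists_bounded_nonregular_equivalent (hX : IsAnalyticNormedSpace X) :
    ∃ K : ℝ, ∀ p q : V → X, rigidityMap G X p = rigidityMap G X q → ¬ IsRegularPlacement G q →
      ∃ q' : V → X, rigidityMap G X p = rigidityMap G X q' ∧ ¬ IsRegularPlacement G q' ∧
        ‖q'‖ ≤ K * ‖p‖ := by
  let root : V → V := fun v => (G.connectedComponentMk v).out
  have hroot : ∀ v, G.Reachable v (root v) := fun v =>
    SimpleGraph.ConnectedComponent.exact (Quot.out_eq (G.connectedComponentMk v)).symm
  have hadj : ∀ v w, G.Adj v w → root v = root w := fun v w h => by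
    simp only [root, SimpleGraph.ConnectedComponent.connectedComponentMk_eq_of_adj h]
  choose K hK0 hK using fun v => exists_norm_sub_le_of_reachable (X := X) (hroot v)
  refine ⟨∑ v, K v, fun p q hpq hq => ⟨q - fun v => q (root v), ?_, ?_, ?_⟩⟩
  · rw [rigidityMap_sub_const fun v w h => by rw [hadj v w h], hpq]
  · exact fun h => hq (isRegularPlacement_of_sub_const hX (fun v w h => by rw [hadj v w h]) h)
  · rw [pi_norm_le_iff_of_nonneg (mul_nonneg (Finset.sum_nonneg fun v _ => hK0 v) (norm_nonneg _))]
    intro v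
    refine (hK v p q hpq).trans ?_
    gcongr
    exact Finset.single_le_sum (fun v _ => hK0 v) (Finset.mem_univ v)

/-- For a convergent sequence in the complement, bounded non-regular witnesses subconverge. The
limit is still equivalent, by continuity of the rigidity map, and still non-regular, as regularity
is open. -/
theorem isOpen_stronglyRegularPlacements [FiniteDimensional ℝ X] (hX : IsAnalyticNormedSpace X) :
    IsOpen (stronglyRegularPlacements G X) := by
  rw [← isClosed_compl_iff]
  have hmem : ∀ p : V → X, p ∈ (stronglyRegularPlacements G X)ᶜ ↔
      ∃ q : V → X, rigidityMap G X p = rigidityMap G X q ∧ ¬ IsRegularPlacement G q := fun p => by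
    rw [Set.mem_compl_iff, mem_stronglyRegularPlacements_iff]
    push Not
    rfl
  obtain ⟨K, hK⟩ := exists_bounded_nonregular_equivalent (G := G) hX
  refine IsSeqClosed.isClosed fun p p₀ hp hlim => ?_
  choose q hq hqn using fun n => (hmem _).1 (hp n)
  choose q' hq' hqn' hbd using fun n => hK _ _ (hq n) (hqn n)
  obtain ⟨M, hM⟩ := (Metric.isBounded_range_of_tendsto p hlim).exists_norm_le
  have : ProperSpace X := FiniteDimensional.proper ℝ X
  -- The sign of `K` is not recorded, hence the absolute value.
  obtain ⟨q₀, -, φ, hφ, hlim'⟩ := tendsto_subseq_of_bounded (x := q')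
    (s := Metric.closedBall 0 (|K| * M)) Metric.isBounded_closedBall fun n => by
      rw [mem_closedBall_zero_iff]
      refine (hbd n).trans ((mul_le_mul_of_nonneg_right (le_abs_self K) (norm_nonneg _)).trans ?_)
      exact mul_le_mul_of_nonneg_left (hM _ ⟨n, rfl⟩) (abs_nonneg K)
  refine (hmem _).2 ⟨q₀, ?_, ?_⟩
  · refine tendsto_nhds_unique
      ((continuous_rigidityMap.tendsto p₀).comp (hlim.comp hφ.tendsto_atTop)) ?_
    have := (continuous_rigidityMap (G := G).tendsto q₀).comp hlim'
    refine this.congr fun n => ?_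
    exact (hq' (φ n)).symm
  · have hcl : IsClosed (regularPlacements G X)ᶜ := (isOpen_regularPlacements hX).isClosed_compl
    exact hcl.mem_of_tendsto hlim' (Filter.Eventually.of_forall fun n => hqn' (φ n))

end Frameworks

/-! ### Conullity -/

section Conull

variable {V : Type*} {G : SimpleGraph V} {X : Type*} [NormedAddCommGroup X] [NormedSpace ℝ X]
  [Fintype V] [FiniteDimensional ℝ X]

section Measure

variable [MeasurableSpace X] [BorelSpace X] (μ : Measure (V → X)) [μ.IsAddHaarMeasure]

theorem measure_setOf_sub_mem_submodule {v w : V} (hvw : v ≠ w) {Y : Submodule ℝ X} (hY : Y ≠ ⊤) :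
    μ {p | p v - p w ∈ Y} = 0 := by
  classical
  let S : Submodule ℝ (V → X) := Y.comap
    (LinearMap.proj (R := ℝ) (φ := fun _ : V => X) v - LinearMap.proj w)
  refine Measure.addHaar_submodule μ S fun hS => hY ?_
  rw [Submodule.eq_top_iff']
  intro x
  have : Pi.single v x ∈ S := hS ▸ Submodule.mem_top
  simpa [S, Pi.single_eq_of_ne hvw.symm] using this

theorem measure_compl_edgeInjectivePlacements [Nontrivial X] :
    μ (edgeInjectivePlacements G X)ᶜ = 0 := by
  have : (edgeInjectivePlacements G X)ᶜ ⊆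
      ⋃ (v : V) (w : V) (_ : G.Adj v w), {p | p v - p w ∈ (⊥ : Submodule ℝ X)} := by
    intro p hp
    simp only [edgeInjectivePlacements, Set.mem_compl_iff, Set.mem_ofPred_eq, not_forall,
      not_not] at hp
    obtain ⟨v, w, hvw, h⟩ := hp
    exact Set.mem_iUnion₂.2 ⟨v, w, Set.mem_iUnion.2 ⟨hvw, by simp [h]⟩⟩
  exact measure_mono_null this (measure_iUnion_null fun v => measure_iUnion_null fun w =>
    measure_iUnion_null fun hvw => measure_setOf_sub_mem_submodule μ hvw.ne bot_ne_top)

/-- If an edge collapses on the segment from `q` to `p`, then `p v - p w` lies on the line through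
`q v - q w`, a proper subspace since the dimension exceeds one. -/
theorem measure_compl_setOf_segment_subset (hdim : 1 < Module.finrank ℝ X) {q : V → X}
    (hq : q ∈ edgeInjectivePlacements G X) :
    μ {p | p ∈ edgeInjectivePlacements G X ∧
      ¬ segment ℝ q p ⊆ edgeInjectivePlacements G X} = 0 := by
  have : {p | p ∈ edgeInjectivePlacements G X ∧ ¬ segment ℝ q p ⊆ edgeInjectivePlacements G X} ⊆
      ⋃ (v : V) (w : V) (_ : G.Adj v w), {p | p v - p w ∈ Submodule.span ℝ {q v - q w}} := by
    rintro p ⟨-, hp⟩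
    obtain ⟨z, ⟨s, t, hs, ht, hst, rfl⟩, hz⟩ := Set.not_subset.1 hp
    simp only [edgeInjectivePlacements, Set.mem_ofPred_eq, not_forall, not_not] at hz
    obtain ⟨v, w, hvw, h⟩ := hz
    refine Set.mem_iUnion₂.2 ⟨v, w, Set.mem_iUnion.2 ⟨hvw, ?_⟩⟩
    simp only [Pi.add_apply, Pi.smul_apply] at h
    have h0 : s • (q v - q w) + t • (p v - p w) = 0 := by
      rw [smul_sub, smul_sub, sub_add_sub_comm, h, sub_self]
    have ht0 : t ≠ 0 := by
      rintro rfl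
      rw [add_zero] at hst
      simp only [hst, one_smul, zero_smul, add_zero] at h0
      exact hq v w hvw (sub_eq_zero.1 h0)
    refine Submodule.mem_span_singleton.2 ⟨-(t⁻¹ * s), ?_⟩
    rw [neg_smul, mul_smul, ← smul_neg, ← eq_neg_of_add_eq_zero_right h0, smul_smul,
      inv_mul_cancel₀ ht0, one_smul]
  refine measure_mono_null this (measure_iUnion_null fun v => measure_iUnion_null fun w =>
    measure_iUnion_null fun hvw => measure_setOf_sub_mem_submodule μ hvw.ne fun h => ?_)
  have h1 := finrank_span_le_card (R := ℝ) {q v - q w}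
  rw [h, finrank_top, Set.toFinset_card, Set.card_singleton] at h1
  omega

variable [Fintype G.edgeSet]

theorem measure_setOf_not_surjective_fderiv_of_one_lt_finrank (hX : IsAnalyticNormedSpace X)
    (hdim : 1 < Module.finrank ℝ X) {n : ℕ} (a : Fin n → G.edgeSet) {q : V → X}
    (hq : q ∈ edgeInjectivePlacements G X)
    (hs : Function.Surjective (fderiv ℝ (partialRigidityMap X a) q)) :
    μ {p | p ∈ edgeInjectivePlacements G X ∧
      ¬ Function.Surjective (fderiv ℝ (partialRigidityMap X a) p)} = 0 := by
  -- Lifts of the standard basis at `q`: evaluating the derivative on them gives a square matrix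
  -- that is the identity at `q`, and a nonzero determinant elsewhere forces surjectivity.
  choose u hu using fun j : Fin n => hs (Pi.single j 1)
  let M : (V → X) → Matrix (Fin n) (Fin n) ℝ := fun p =>
    Matrix.of fun i j => fderiv ℝ (partialRigidityMap X a) p (u j) i
  have hM : AnalyticOnNhd ℝ (fun p => (M p).det) (edgeInjectivePlacements G X) := by
    intro p hp
    have hent : ∀ i j, AnalyticAt ℝ (fun p => M p i j) p := fun i j =>
      ((((ContinuousLinearMap.proj (R := ℝ) (φ := fun _ : Fin n => ℝ) i).comp
        (ContinuousLinearMap.apply ℝ (Fin n → ℝ) (u j))).analyticAt _).comp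
        (analyticOnNhd_partialRigidityMap hX a p hp).fderiv)
    simp only [Matrix.det_apply']
    exact Finset.analyticAt_fun_sum _ fun σ _ =>
      analyticAt_const.mul (Finset.analyticAt_fun_prod _ fun i _ => hent _ _)
  have hMq : (M q).det = 1 := by
    have : M q = 1 := by
      ext i j
      simp only [M, Matrix.of_apply, hu, Matrix.one_apply, Pi.single_apply]
    rw [this, Matrix.det_one]
  have hsurj : ∀ p, (M p).det ≠ 0 → Function.Surjective (fderiv ℝ (partialRigidityMap X a) p) := by
    intro p hp c
    refine ⟨∑ j, ((M p)⁻¹.mulVec c) j • u j, ?_⟩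
    have h1 : (M p).mulVec ((M p)⁻¹.mulVec c) = c := by
      rw [Matrix.mulVec_mulVec, Matrix.mul_nonsing_inv _ hp.isUnit, Matrix.one_mulVec]
    ext i
    refine Eq.trans ?_ (congrFun h1 i)
    simp only [map_sum, map_smul, Finset.sum_apply, Pi.smul_apply, smul_eq_mul]
    exact Finset.sum_congr rfl fun j _ => mul_comm _ _
  -- Star-shaped about `q`, so connected: a determinant vanishing near one point of `S` would vanish
  -- at `q`, where it is 1.
  let S : Set (V → X) := {p | segment ℝ q p ⊆ edgeInjectivePlacements G X}
  have hSP : S ⊆ edgeInjectivePlacements G X := fun p hp => hp (right_mem_segment ℝ q p)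
  have hqS : q ∈ S := by
    change segment ℝ q q ⊆ _
    rw [segment_same]
    exact Set.singleton_subset_iff.2 hq
  have hstar : StarConvex ℝ q S := by
    rw [starConvex_iff_segment_subset]
    intro p hp z hz
    exact ((convex_segment q p).segment_subset (left_mem_segment ℝ q p) hz).trans hp
  have hpre : IsPreconnected S := (hstar.isPathConnected hqS).isConnected.isPreconnected
  have hnull := measure_zeros_analytic_eq_zero μ (hM.mono hSP) fun p hp h0 => by
    have := (hM.mono hSP).eqOn_zero_of_preconnected_of_eventuallyEq_zero hpre hp h0 hqS
    simp [hMq] at this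
  refine measure_mono_null ?_
    (measure_union_null (measure_compl_setOf_segment_subset μ hdim hq) hnull)
  rintro p ⟨hp, hns⟩
  by_cases hpS : p ∈ S
  · exact Or.inr ⟨hpS, by_contra fun h => hns (hsurj p h)⟩
  · exact Or.inl ⟨hp, hpS⟩

end Measure

variable [Fintype G.edgeSet]

/-- In dimension one, the rigidity operators at any two placements differ by an invertible diagonal
matrix. -/
theorem exists_rigidityOperator_eq_mul_of_finrank_eq_one (hX : IsAnalyticNormedSpace X)
    (hdim : Module.finrank ℝ X = 1) {p q : V → X} (hp : p ∈ edgeInjectivePlacements G X)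
    (hq : q ∈ edgeInjectivePlacements G X) (e : G.edgeSet) :
    ∃ k : ℝ, k ≠ 0 ∧ ∀ u : V → X, rigidityOperator G p u e = k * rigidityOperator G q u e := by
  let T : X ≃L[ℝ] ℝ := ContinuousLinearEquiv.ofFinrankEq (by rw [hdim, Module.finrank_self])
  have hnorm : ∀ x, ‖x‖ = |T x| * ‖T.symm 1‖ := fun x => by
    rw [← Real.norm_eq_abs, ← norm_smul, ← map_smul, smul_eq_mul, mul_one, T.symm_apply_apply]
  obtain ⟨⟨v, w⟩, hvw⟩ := e
  let d : (V → X) →L[ℝ] ℝ := (T : X →L[ℝ] ℝ).comp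
    (ContinuousLinearMap.proj (R := ℝ) (φ := fun _ : V => X) v - ContinuousLinearMap.proj w)
  have hd : ∀ r ∈ edgeInjectivePlacements G X, ∀ u,
      rigidityOperator G r u ⟨s(v, w), hvw⟩ = ‖T.symm 1‖ ^ 2 * (d r * d u) := by
    intro r hr u
    have h1 := (ContinuousLinearMap.proj (R := ℝ) (φ := fun _ : G.edgeSet => ℝ)
      ⟨s(v, w), hvw⟩).hasFDerivAt.comp r
      (analyticOnNhd_rigidityMap hX r hr).differentiableAt.hasFDerivAt
    have h2 : HasFDerivAt (fun r : V → X => 1 / 2 * ‖T.symm 1‖ ^ 2 * (d r * d r))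
        ((1 / 2 * ‖T.symm 1‖ ^ 2) • (d r • d + d r • d)) r :=
      (d.hasFDerivAt.mul d.hasFDerivAt).const_mul _
    have h3 : (fun r : V → X => 1 / 2 * ‖T.symm 1‖ ^ 2 * (d r * d r)) =
        fun r => rigidityMap G X r ⟨s(v, w), hvw⟩ := by
      funext r
      change _ = 1 / 2 * ‖r v - r w‖ ^ 2
      rw [hnorm (r v - r w), mul_pow, sq_abs]
      simp only [d, ContinuousLinearMap.comp_apply, sub_apply, ContinuousLinearMap.proj_apply,
        ContinuousLinearEquiv.coe_coe]
      ring
    rw [h3] at h2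
    refine (congrArg (fun L => L u) (h1.unique h2)).trans ?_
    simp only [smul_apply, add_apply, smul_eq_mul]
    ring
  have hne : ∀ r ∈ edgeInjectivePlacements G X, d r ≠ 0 := fun r hr h =>
    hr v w hvw (sub_eq_zero.1 ((map_eq_zero_iff T T.injective).1 h))
  refine ⟨d p / d q, div_ne_zero (hne p hp) (hne q hq), fun u => ?_⟩
  refine (hd p hp u).trans (Eq.trans ?_ (congrArg (fun z => d p / d q * z) (hd q hq u)).symm)
  have := hne q hq
  field_simp

/-- On a line the segment argument fails, as collapsed edges can disconnect the space of placements.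
Instead the rows at `p` and `q` are nonzero multiples of each other, so the target is rescaled
coordinatewise. -/
theorem surjective_fderiv_partialRigidityMap_of_finrank_eq_one (hX : IsAnalyticNormedSpace X)
    (hdim : Module.finrank ℝ X = 1) {n : ℕ} (a : Fin n → G.edgeSet) {p q : V → X}
    (hp : p ∈ edgeInjectivePlacements G X) (hq : q ∈ edgeInjectivePlacements G X)
    (hs : Function.Surjective (fderiv ℝ (partialRigidityMap X a) q)) :
    Function.Surjective (fderiv ℝ (partialRigidityMap X a) p) := by
  choose k hk0 hk using exists_rigidityOperator_eq_mul_of_finrank_eq_one hX hdim hp hq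
  intro c
  obtain ⟨u, hu⟩ := hs fun i => c i / k (a i)
  refine ⟨u, ?_⟩
  rw [fderiv_partialRigidityMap hX a hq] at hu
  rw [fderiv_partialRigidityMap hX a hp]
  ext i
  have := congrFun hu i
  rw [coordRestrict_apply] at this
  rw [coordRestrict_apply, hk, this, mul_div_cancel₀ _ (hk0 _)]

section Measure

variable [Nontrivial X] [MeasurableSpace X] [BorelSpace X] (μ : Measure (V → X))
  [μ.IsAddHaarMeasure]

theorem measure_setOf_not_surjective_fderiv (hX : IsAnalyticNormedSpace X) {n : ℕ}
    (a : Fin n → G.edgeSet) {q : V → X} (hq : q ∈ edgeInjectivePlacements G X)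
    (hs : Function.Surjective (fderiv ℝ (partialRigidityMap X a) q)) :
    μ {p | p ∈ edgeInjectivePlacements G X ∧
      ¬ Function.Surjective (fderiv ℝ (partialRigidityMap X a) p)} = 0 := by
  rcases (Nat.succ_le_of_lt (Module.finrank_pos (R := ℝ) (M := X))).eq_or_lt with h | h
  · convert measure_empty (μ := μ)
    ext p
    simp only [Set.mem_ofPred_eq, Set.mem_empty_iff_false, iff_false, not_and, not_not]
    exact fun hp => surjective_fderiv_partialRigidityMap_of_finrank_eq_one hX h.symm a hp hq hs
  · exact measure_setOf_not_surjective_fderiv_of_one_lt_finrank μ hX h a hq hs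

/-- If some `q` has larger rank than `p`, edges realising the rank at `q` give a partial map that is
critical at `p`; there are countably many choices of edges. -/
theorem measure_compl_regularPlacements (hX : IsAnalyticNormedSpace X) :
    μ (regularPlacements G X)ᶜ = 0 := by
  have hsub : (regularPlacements G X)ᶜ ⊆ (edgeInjectivePlacements G X)ᶜ ∪
      ⋃ (n : ℕ) (a : Fin n → G.edgeSet) (_ : ∃ q ∈ edgeInjectivePlacements G X,
        Function.Surjective (fderiv ℝ (partialRigidityMap X a) q)),
        {p | p ∈ edgeInjectivePlacements G X ∧
          ¬ Function.Surjective (fderiv ℝ (partialRigidityMap X a) p)} := by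
    intro p hp
    by_cases hpP : p ∈ edgeInjectivePlacements G X
    · right
      obtain ⟨q, hq, hlt⟩ : ∃ q, IsWellPositioned G q ∧ rigidityRank G p < rigidityRank G q := by
        by_contra! hcon
        exact hp ⟨(isWellPositioned_iff hX).2 hpP, hcon⟩
      have hqP := (isWellPositioned_iff hX).1 hq
      obtain ⟨a, ha⟩ := exists_surjective_fderiv_partialRigidityMap hX hqP
      refine Set.mem_iUnion₂.2 ⟨_, a, Set.mem_iUnion.2 ⟨⟨q, hqP, ha⟩, hpP, fun hs => ?_⟩⟩
      exact absurd (le_rigidityRank hX hpP hs) (not_le.2 hlt)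
    · exact Or.inl hpP
  refine measure_mono_null hsub (measure_union_null (measure_compl_edgeInjectivePlacements μ)
    (measure_iUnion_null fun n => measure_iUnion_null fun a => measure_iUnion_null ?_))
  rintro ⟨q, hq, hs⟩
  exact measure_setOf_not_surjective_fderiv μ hX a hq hs

theorem measure_compl_stronglyRegularPlacements (hX : IsAnalyticNormedSpace X) :
    μ (stronglyRegularPlacements G X)ᶜ = 0 := by
  have hsub : (stronglyRegularPlacements G X)ᶜ ⊆ (regularPlacements G X)ᶜ ∪
      ⋃ (n : ℕ) (a : Fin n → G.edgeSet),
        {p | p ∈ edgeInjectivePlacements G X ∧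
          Function.Surjective (fderiv ℝ (partialRigidityMap X a) p)} ∩
        partialRigidityMap X a ⁻¹' (partialRigidityMap X a ''
          {p | p ∈ edgeInjectivePlacements G X ∧
            ¬ Function.Surjective (fderiv ℝ (partialRigidityMap X a) p)}) := by
    intro p hp
    by_cases hpR : p ∈ regularPlacements G X
    · right
      obtain ⟨q, hpq, hq⟩ : ∃ q, rigidityMap G X p = rigidityMap G X q ∧
          ¬ IsRegularPlacement G q := by
        by_contra! hcon
        exact hp (mem_stronglyRegularPlacements_iff.2 hcon)
      have hpP := (isWellPositioned_iff hX).1 hpR.1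
      have hqP := edgeInjectivePlacements_congr hpq.symm hpP
      obtain ⟨a, ha⟩ := exists_surjective_fderiv_partialRigidityMap hX hpP
      -- Were the partial map submersive at `q`, the rank there would reach the maximal rank
      -- attained at `p`, making `q` regular.
      refine Set.mem_iUnion₂.2 ⟨_, a, ⟨hpP, ha⟩, q, ⟨hqP, fun hs => hq ?_⟩, ?_⟩
      · exact ⟨(isWellPositioned_iff hX).2 hqP,
          fun r hr => (hpR.2 r hr).trans (le_rigidityRank hX hqP hs)⟩
      · rw [partialRigidityMap, partialRigidityMap, hpq]
    · exact Or.inl hpR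
  refine measure_mono_null hsub (measure_union_null (measure_compl_regularPlacements μ hX)
    (measure_iUnion_null fun n => measure_iUnion_null fun a => ?_))
  exact measure_preimage_null_of_submersion μ volume
    (fun p hp => analyticOnNhd_partialRigidityMap hX a p hp.1) (fun p hp => hp.2)
    ((analyticOnNhd_partialRigidityMap hX a).volume_image_critical_eq_zero
      isOpen_edgeInjectivePlacements)

end Measure

end Conull

/-! ### The four sets -/

theorem propositionp {X : Type*} [NormedAddCommGroup X] [NormedSpace ℝ X] [FiniteDimensional ℝ X]
    [Nontrivial X] [MeasurableSpace X] [BorelSpace X] (hX : IsAnalyticNormedSpace X)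
    {V : Type*} [Finite V] (G : SimpleGraph V) :
    (IsOpen (stronglyRegularPlacements G X) ∧ IsConullSet (stronglyRegularPlacements G X)) ∧
    (IsOpen (completelyStronglyRegularPlacements V X) ∧
      IsConullSet (completelyStronglyRegularPlacements V X)) ∧
    (IsOpen (regularPlacements G X) ∧ IsConullSet (regularPlacements G X)) ∧
    (IsOpen (completelyRegularPlacements V X) ∧
      IsConullSet (completelyRegularPlacements V X)) := by
  classical
  cases nonempty_fintype V
  have hfin : ∀ H : SimpleGraph V, Nonempty (Fintype H.edgeSet) := fun H => ⟨Fintype.ofFinite _⟩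
  have hstr : ∀ H : SimpleGraph V, IsOpen (stronglyRegularPlacements H X) ∧
      IsConullSet (stronglyRegularPlacements H X) := fun H => by
    obtain ⟨_⟩ := hfin H
    exact ⟨isOpen_stronglyRegularPlacements hX,
      fun μ hμ => measure_compl_stronglyRegularPlacements μ hX⟩
  have hreg : ∀ H : SimpleGraph V, IsOpen (regularPlacements H X) ∧
      IsConullSet (regularPlacements H X) := fun H => by
    obtain ⟨_⟩ := hfin H
    exact ⟨isOpen_regularPlacements hX, fun μ hμ => measure_compl_regularPlacements μ hX⟩
  have hinter : ∀ S : SimpleGraph V → Set (V → X), (∀ H, IsOpen (S H) ∧ IsConullSet (S H)) →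
      IsOpen (⋂ H, S H) ∧ IsConullSet (⋂ H, S H) := fun S hS =>
    ⟨isOpen_iInter_of_finite fun H => (hS H).1, fun μ hμ => by
      rw [Set.compl_iInter]
      exact measure_iUnion_null fun H => (hS H).2 μ hμ⟩
  have hcomstr : completelyStronglyRegularPlacements V X =
      ⋂ H : SimpleGraph V, stronglyRegularPlacements H X := by
    ext p
    rw [Set.mem_iInter]
    exact ⟨fun h H => (h H).2, fun h H => ⟨(h H).1, h H⟩⟩
  have hcom : completelyRegularPlacements V X =
      ⋂ H : SimpleGraph V, regularPlacements H X := by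
    ext p
    rw [Set.mem_iInter]
    exact ⟨fun h H => (h H).2, fun h H => ⟨(h H).1, h H⟩⟩
  rw [hcomstr, hcom]
  exact ⟨hstr G, hinter _ hstr, hreg G, hinter _ hreg⟩
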